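/- Let $\alpha>0$, $b>0$, $\sigma>0$ and $a,v_0\in\mathbb R$, let $(w_t)_{t\ge0}$ be a standard Brownian motion on a probability space $(\Omega,\mathcal F,P)$, and let $(v_t)_{t\ge0}$ be a continuous solution of the stochastic differential equation $$dv_t=(a-b\,e^{\alpha v_t})\,dt+\sigma\,dw_t$$ started at $v_0$, i.e. almost surely $v_t=v_0+\int_0^t(a-b\,e^{\alpha v_s})\,ds+\sigma w_t$ for all $t\ge0$. Put $V_t=e^{2v_t}$ (so $V_0=e^{2v_0}$), and for $t>0$ let $\textsc{vs}(t)=\frac1t\int_0^t\mathbb E[V_s]\,ds$. Then $V_t$ is integrable for every $t\ge0$, the function $s\mapsto\mathbb E[V_s]$ is integrable on $[0,t]$ for every $t>0$, and, with $$\kappa=2a+\frac{(2\sigma)^2}{2}-2bV_0^{\alpha/2}=2a+2\sigma^2-2bV_0^{\alpha/2},$$ as $t\downarrow0$: $$\mathbb E[V_t]\sim V_0(1+\kappa t),\qquad \textsc{vs}(t)\sim V_0\Bigl(1+\kappa\frac t2\Bigr),$$ both in the sense that the ratio of the two sides tends to $1$ and in the sense of first-order expansions, that is, $$\mathbb E[V_t]=V_0(1+\kappa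 t)+o(t),\qquad \textsc{vs}(t)=V_0\Bigl(1+\kappa\frac t2\Bigr)+o(t).$$ -/

import Mathlib

open MeasureTheory ProbabilityTheory Filter Topology
open scoped NNReal Asymptotics

/-- `v` is a solution on `[0, ∞)` of the stochastic differential equation
`dv_t = (a - b exp (α v_t)) dt + σ dw_t` with initial value `v₀`: almost surely the path of `v` is
continuous and satisfies, for all `t`,
`v_t = v₀ + ∫_0^t (a - b exp (α v_s)) ds + σ w_t`.
The noise is additive and a Brownian motion starts almost surely at `0`, so the stochastic integral
`∫_0^t σ dw_s` is `σ w_t`. Adaptedness of `v` is not demanded (the equation has only one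
pathwise solution). -/
structure IsLogVolSolution {Ω : Type*} [MeasurableSpace Ω] (P : Measure Ω)
    (a b α σ v₀ : ℝ) (w v : ℝ≥0 → Ω → ℝ) : Prop where
  continuous_paths : ∀ᵐ ω ∂P, Continuous fun t : ℝ≥0 => v t ω
  equation : ∀ᵐ ω ∂P, ∀ t : ℝ≥0,
    v t ω = v₀ + (∫ s in (0 : ℝ)..(t : ℝ), (a - b * Real.exp (α * v s.toNNReal ω))) + σ * w t ω

/-- The instantaneous variance `V_t = exp (2 v_t)`. -/
noncomputable def instVariance {Ω : Type*} (v : ℝ≥0 → Ω → ℝ) (t : ℝ≥0) (ω : Ω) : ℝ :=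
  Real.exp (2 * v t ω)

/-- The expectation `𝔼[V_t]` as a function of the real time `t ≥ 0`. -/
noncomputable def expVariance {Ω : Type*} [MeasurableSpace Ω] (P : Measure Ω)
    (v : ℝ≥0 → Ω → ℝ) (t : ℝ) : ℝ :=
  ∫ ω, instVariance v t.toNNReal ω ∂P

/-- The variance swap value `vs(t)`, given by `t * vs(t) = ∫_0^t 𝔼[V_s] ds`, for `t > 0`. -/
noncomputable def varianceSwap {Ω : Type*} [MeasurableSpace Ω] (P : Measure Ω)
    (v : ℝ≥0 → Ω → ℝ) (t : ℝ) : ℝ :=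
  (∫ s in (0 : ℝ)..t, expVariance P v s) / t

/-!
No stochastic calculus is needed, because the equation can be solved path by path. With
`X_t = v₀ + a t + σ w_t` and `A_t = ∫_0^t exp (α v_s) ds`, the equation says `v = X - b A`, so
`exp (α b A)` has derivative `α b exp (α X)`. Hence `exp (α b A_t) = 1 + α b Y_t` with
`Y_t = ∫_0^t exp (α X_s) ds`, and
`V_t = exp (2 X_t) (1 + α b Y_t) ^ (-2 / α)` (`eq_sub_log_of_integral_equation`,
`IsLogVolSolution.instVariance_eq_explicitVariance`). This formula gives measurability, and
`V_t ≤ exp (2 X_t)` gives integrability.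

For the expansion of `𝔼[V_t]`, the factor `(1 + α b Y) ^ (-2 / α)` lies between `1 - 2 b Y` and
`1 - 2 b Y + C Y ^ 2`. The moment `𝔼[exp (2 X_t)]` is explicit, with slope
`exp (2 v₀) (2 a + 2 σ ^ 2)` at `0`. The moment `𝔼[exp (p X_t) ∫_0^t exp (q X_s) ds]` is
`t exp ((p + q) v₀) + o(t)`
(`tendsto_integral_exp_mul_intervalIntegral_driftedNoise`); for `p = 2`, `q = α` it gives the linear
term, and for `p = 2`, `q = 2 α`, with `Y_t ^ 2 ≤ t ∫_0^t exp (2 α X_s) ds`, it shows that the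
quadratic term is `O(t ^ 2)`. Averaging over `[0, t]` then halves the slope
(`isLittleO_average_sub_affine`), and since the leading coefficient `V₀` is not zero, the
expansions imply the asymptotic equivalences.
-/

/-! ### Measurability of the noise -/

/-- A Brownian motion, whose marginals are only almost everywhere measurable and whose paths are
only almost surely continuous, agrees off a null set with a process that has measurable marginals
and continuous paths without exception. -/
lemma ProbabilityTheory.IsBrownianReal.exists_measurable_continuous_version
    {Ω : Type*} [MeasurableSpace Ω] {P : Measure Ω} {w : ℝ≥0 → Ω → ℝ} (hw : IsBrownianReal w P) :
    ∃ W : ℝ≥0 → Ω → ℝ, (∀ t, Measurable (W t)) ∧ (∀ ω, Continuous fun t => W t ω) ∧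
      ∀ᵐ ω ∂P, ∀ t, W t ω = w t ω := by
  have hae : ∀ᵐ ω ∂P, Continuous (fun t => w t ω) ∧
      ∀ n k : ℕ, w (k / n) ω = (hw.aemeasurable (k / n)).mk _ ω := by
    filter_upwards [hw.cont, ae_all_iff.2 fun n : ℕ => ae_all_iff.2 fun k : ℕ =>
      (hw.aemeasurable (k / n)).ae_eq_mk] with ω h₁ h₂ using ⟨h₁, h₂⟩
  obtain ⟨N, hbad, hN, hN0⟩ := exists_measurable_superset_of_null (ae_iff.1 hae)
  have hgood : ∀ ω, ω ∈ Nᶜ → Continuous (fun t => w t ω) ∧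
      ∀ n k : ℕ, w (k / n) ω = (hw.aemeasurable (k / n)).mk _ ω := by
    intro ω hω
    by_contra h
    exact hω (hbad h)
  refine ⟨fun t => Nᶜ.indicator (w t), fun t => ?_, fun ω => ?_, ?_⟩
  · -- On the good set, `w t` is the limit of the measurable versions at rational times.
    refine measurable_of_tendsto_metrizable
      (f := fun n : ℕ => Nᶜ.indicator ((hw.aemeasurable ((⌊(t : ℝ) * n⌋₊ : ℕ) / (n : ℝ≥0))).mk _))
      (fun n => (hw.aemeasurable _).measurable_mk.indicator hN.compl) (tendsto_pi_nhds.2 fun ω => ?_)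
    by_cases hω : ω ∈ Nᶜ
    · obtain ⟨hc, hq⟩ := hgood ω hω
      simp only [Set.indicator_of_mem hω, ← hq]
      refine (hc.tendsto t).comp (NNReal.tendsto_coe.1 ?_)
      have := (tendsto_nat_floor_mul_div_atTop t.coe_nonneg).comp tendsto_natCast_atTop_atTop
      refine this.congr fun n => ?_
      simp
    · simp only [Set.indicator_of_notMem hω]
      exact tendsto_const_nhds
  · by_cases hω : ω ∈ Nᶜ
    · simpa only [Set.indicator_of_mem hω] using (hgood ω hω).1
    · simpa only [Set.indicator_of_notMem hω] using continuous_const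
  · have : ∀ᵐ ω ∂P, ω ∈ Nᶜ := measure_eq_zero_iff_ae_notMem.1 hN0
    filter_upwards [this] with ω hω t
    exact Set.indicator_of_mem hω _

/-! ### Solving the equation pathwise -/

/-- The explicit solution of `y' = a - b exp (α y) + x'`, written as an integral equation with a
continuous additive input `x`. -/
lemma eq_sub_log_of_integral_equation {a b α v₀ : ℝ} (hα : 0 < α)
    {y x : ℝ → ℝ} (hy : Continuous y)
    (h : ∀ t, 0 ≤ t → y t = v₀ + (∫ s in (0 : ℝ)..t, (a - b * Real.exp (α * y s))) + x t)
    {t : ℝ} (ht : 0 ≤ t) :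
    y t = v₀ + a * t + x t -
      Real.log (1 + α * b * ∫ s in (0 : ℝ)..t, Real.exp (α * (v₀ + a * s + x s))) / α := by
  have hcont : Continuous fun s => Real.exp (α * y s) := by fun_prop
  set A : ℝ → ℝ := fun t => ∫ s in (0 : ℝ)..t, Real.exp (α * y s) with hA
  have hyA : ∀ t, 0 ≤ t → y t = v₀ + a * t + x t - b * A t := by
    intro t ht
    rw [h t ht, intervalIntegral.integral_sub (by simp) ((hcont.const_mul b).intervalIntegrable _ _),
      intervalIntegral.integral_const_mul]
    simp only [intervalIntegral.integral_const, smul_eq_mul, hA]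
    ring
  have hAd : ∀ s, HasDerivAt A (Real.exp (α * y s)) s := fun s =>
    intervalIntegral.integral_hasDerivAt_right (hcont.intervalIntegrable _ _)
      (hcont.stronglyMeasurableAtFilter _ _) hcont.continuousAt
  have hEd : ∀ s, HasDerivAt (fun s => Real.exp (α * b * A s))
      (Real.exp (α * b * A s) * (α * b * Real.exp (α * y s))) s := fun s =>
    ((hAd s).const_mul (α * b)).exp
  have hAc : Continuous A := continuous_iff_continuousAt.2 fun s => (hAd s).continuousAt
  -- The integrating factor `exp (α b A)` has derivative `α b exp (α (v₀ + a s + x s))`.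
  have hint : Real.exp (α * b * A t) =
      1 + α * b * ∫ s in (0 : ℝ)..t, Real.exp (α * (v₀ + a * s + x s)) := by
    have h₁ := intervalIntegral.integral_eq_sub_of_hasDerivAt (a := 0) (b := t)
      (fun s _ => hEd s) (Continuous.intervalIntegrable (by fun_prop) _ _)
    have h₂ : (∫ s in (0 : ℝ)..t, Real.exp (α * b * A s) * (α * b * Real.exp (α * y s))) =
        ∫ s in (0 : ℝ)..t, α * b * Real.exp (α * (v₀ + a * s + x s)) := by
      refine intervalIntegral.integral_congr fun s hs => ?_
      rw [Set.uIcc_of_le ht] at hs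
      have : α * (v₀ + a * s + x s) = α * b * A s + α * y s := by rw [hyA s hs.1]; ring
      simp only [this, Real.exp_add]
      ring
    have hA0 : A 0 = 0 := by simp [hA]
    rw [h₂, intervalIntegral.integral_const_mul, hA0, mul_zero, Real.exp_zero] at h₁
    linarith
  rw [← hint, Real.log_exp, hyA t ht]
  field_simp

/-! ### Bounds for the discount factor and for squared integrals -/

lemma one_sub_le_exp_neg_log {α b y : ℝ} (hα : 0 < α) (hb : 0 < b) (hy : 0 ≤ y) :
    1 - 2 * b * y ≤ Real.exp (-(2 / α * Real.log (1 + α * b * y))) := by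
  have h₁ : Real.log (1 + α * b * y) ≤ α * b * y := by
    have := Real.log_le_sub_one_of_pos (x := 1 + α * b * y) (by positivity)
    linarith
  have h₂ : 2 / α * Real.log (1 + α * b * y) ≤ 2 * b * y := by
    calc 2 / α * Real.log (1 + α * b * y) ≤ 2 / α * (α * b * y) := by gcongr
      _ = 2 * b * y := by field_simp
  linarith [Real.add_one_le_exp (-(2 / α * Real.log (1 + α * b * y)))]

lemma exp_neg_le_quadratic {z : ℝ} (hz : 0 ≤ z) : Real.exp (-z) ≤ 1 - z + z ^ 2 := by
  have h : Real.exp (-z) * (1 + z) ≤ 1 := by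
    calc Real.exp (-z) * (1 + z) ≤ Real.exp (-z) * Real.exp z := by
          gcongr; linarith [Real.add_one_le_exp z]
      _ = 1 := by rw [← Real.exp_add]; simp
  have h' : Real.exp (-z) ≤ 1 / (1 + z) := by rwa [le_div_iff₀ (by linarith)]
  refine h'.trans ((div_le_iff₀ (by linarith)).2 ?_)
  nlinarith [pow_nonneg hz 3]

lemma exp_neg_log_le_quadratic {α b y : ℝ} (hα : 0 < α) (hb : 0 < b) (hy : 0 ≤ y) :
    Real.exp (-(2 / α * Real.log (1 + α * b * y))) ≤
      1 - 2 * b * y + (2 * α * b ^ 2 + 4 * b ^ 2) * y ^ 2 := by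
  have hx : 0 ≤ α * b * y := by positivity
  set l := Real.log (1 + α * b * y) with hl
  have hl₀ : 0 ≤ l := Real.log_nonneg (by linarith)
  have hl₁ : l ≤ α * b * y := by
    have := Real.log_le_sub_one_of_pos (x := 1 + α * b * y) (by positivity)
    linarith
  have hl₂ : α * b * y - (α * b * y) ^ 2 ≤ l := by
    have h₁ := Real.one_sub_inv_le_log_of_pos (x := 1 + α * b * y) (by positivity)
    have h₂ : (1 + α * b * y)⁻¹ ≤ 1 - α * b * y + (α * b * y) ^ 2 := by
      rw [inv_le_iff_one_le_mul₀ (by positivity)]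
      nlinarith [pow_nonneg hx 3]
    linarith
  have hz₁ : 2 / α * l ≤ 2 * b * y := by
    calc 2 / α * l ≤ 2 / α * (α * b * y) := by gcongr
      _ = 2 * b * y := by field_simp
  have hz₂ : 2 * b * y - 2 * α * b ^ 2 * y ^ 2 ≤ 2 / α * l := by
    calc 2 * b * y - 2 * α * b ^ 2 * y ^ 2 = 2 / α * (α * b * y - (α * b * y) ^ 2) := by
          field_simp
      _ ≤ 2 / α * l := by gcongr
  have hz₀ : 0 ≤ 2 / α * l := by positivity
  have hsq : (2 / α * l) ^ 2 ≤ (2 * b * y) ^ 2 := by gcongr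
  have := exp_neg_le_quadratic hz₀
  nlinarith

/-- The Cauchy-Schwarz inequality for a function and the constant `1` on `[0, t]`. -/
lemma sq_intervalIntegral_le {f : ℝ → ℝ} (hf : Continuous f) {t : ℝ} (ht : 0 < t) :
    (∫ s in (0 : ℝ)..t, f s) ^ 2 ≤ t * ∫ s in (0 : ℝ)..t, f s ^ 2 := by
  set m := (∫ s in (0 : ℝ)..t, f s) / t with hm
  have h₀ : 0 ≤ ∫ s in (0 : ℝ)..t, (f s - m) ^ 2 :=
    intervalIntegral.integral_nonneg ht.le fun s _ => sq_nonneg _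
  have h₁ : (∫ s in (0 : ℝ)..t, (f s - m) ^ 2) =
      (∫ s in (0 : ℝ)..t, f s ^ 2) - 2 * m * (∫ s in (0 : ℝ)..t, f s) + m ^ 2 * t := by
    have : ∀ s, (f s - m) ^ 2 = f s ^ 2 - 2 * m * f s + m ^ 2 := fun s => by ring
    simp only [this]
    rw [intervalIntegral.integral_add (Continuous.intervalIntegrable (by fun_prop) _ _) (by simp),
      intervalIntegral.integral_sub (Continuous.intervalIntegrable (by fun_prop) _ _)
        (Continuous.intervalIntegrable (by fun_prop) _ _), intervalIntegral.integral_const_mul]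
    simp [mul_comm]
  have hI : (∫ s in (0 : ℝ)..t, f s) = m * t := by rw [hm]; field_simp
  rw [h₁, hI] at h₀
  rw [hI]
  nlinarith

/-! ### Brownian motion with drift and its exponential moments -/

/-- Brownian motion with drift, `v₀ + a t + σ W_t`, indexed by the real time `t`; at negative times
the noise is frozen at its value at time `0`. -/
noncomputable def driftedNoise {Ω : Type*} (v₀ a σ : ℝ) (W : ℝ≥0 → Ω → ℝ) (t : ℝ) (ω : Ω) : ℝ :=
  v₀ + a * t + σ * W t.toNNReal ω

section DriftedNoise

variable {Ω : Type*} {v₀ a σ : ℝ} {W : ℝ≥0 → Ω → ℝ}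

@[fun_prop]
lemma continuous_driftedNoise (hWc : ∀ ω, Continuous fun t => W t ω) (ω : Ω) :
    Continuous fun t => driftedNoise v₀ a σ W t ω := by
  have := (hWc ω).comp continuous_real_toNNReal
  unfold driftedNoise
  exact (by fun_prop : Continuous fun t : ℝ => v₀ + a * t).add (this.const_mul σ)

lemma exp_mul_intervalIntegral_driftedNoise (p q t : ℝ) (ω : Ω) :
    Real.exp (p * driftedNoise v₀ a σ W t ω) *
        ∫ s in (0 : ℝ)..t, Real.exp (q * driftedNoise v₀ a σ W s ω) =
      ∫ s in (0 : ℝ)..t, Real.exp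
        (p * driftedNoise v₀ a σ W t ω + q * driftedNoise v₀ a σ W s ω) := by
  simp only [Real.exp_add, intervalIntegral.integral_const_mul]

variable [MeasurableSpace Ω] {P : Measure Ω}

lemma measurable_driftedNoise (hWm : ∀ t, Measurable (W t)) (t : ℝ) :
    Measurable (driftedNoise v₀ a σ W t) :=
  ((hWm _).const_mul σ).const_add _

lemma measurable_uncurry_driftedNoise (hWm : ∀ t, Measurable (W t))
    (hWc : ∀ ω, Continuous fun t => W t ω) :
    Measurable (Function.uncurry (driftedNoise v₀ a σ W)) :=
  measurable_uncurry_of_continuous_of_measurable (continuous_driftedNoise hWc)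
    (measurable_driftedNoise hWm)

lemma integrable_exp_driftedNoise (hW : IsPreBrownianReal W P) (p t : ℝ) :
    Integrable (fun ω => Real.exp (p * driftedNoise v₀ a σ W t ω)) P := by
  have h := (hW.hasLaw_eval t.toNNReal)
  have h₁ : Integrable (fun ω => Real.exp ((p * σ) * W t.toNNReal ω)) P := by
    have := integrable_exp_mul_gaussianReal (μ := 0) (v := t.toNNReal) (p * σ)
    rw [← h.map_eq] at this
    exact this.comp_aemeasurable h.aemeasurable
  refine (h₁.const_mul (Real.exp (p * (v₀ + a * t)))).congr (ae_of_all _ fun ω => ?_)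
  simp only [driftedNoise, ← Real.exp_add]
  ring_nf

lemma integral_exp_driftedNoise (hW : IsPreBrownianReal W P) (p : ℝ) {t : ℝ} (ht : 0 ≤ t) :
    ∫ ω, Real.exp (p * driftedNoise v₀ a σ W t ω) ∂P =
      Real.exp (p * v₀ + (p * a + p ^ 2 * σ ^ 2 / 2) * t) := by
  have h := mgf_gaussianReal (hW.hasLaw_eval t.toNNReal).map_eq (p * σ)
  rw [mgf, Real.coe_toNNReal _ ht] at h
  calc ∫ ω, Real.exp (p * driftedNoise v₀ a σ W t ω) ∂P
      = ∫ ω, Real.exp (p * (v₀ + a * t)) * Real.exp ((p * σ) * W t.toNNReal ω) ∂P := by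
        refine integral_congr_ae (ae_of_all _ fun ω => ?_)
        simp only [driftedNoise, ← Real.exp_add]
        ring_nf
    _ = Real.exp (p * v₀ + (p * a + p ^ 2 * σ ^ 2 / 2) * t) := by
        rw [integral_const_mul, h, ← Real.exp_add]
        ring_nf

lemma integrable_driftedNoise [IsProbabilityMeasure P] (hW : IsPreBrownianReal W P) (t : ℝ) :
    Integrable (driftedNoise v₀ a σ W t) P :=
  (integrable_const _).add ((hW.integrable_eval t.toNNReal).const_mul σ)

lemma integral_driftedNoise [IsProbabilityMeasure P] (hW : IsPreBrownianReal W P) (t : ℝ) :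
    ∫ ω, driftedNoise v₀ a σ W t ω ∂P = v₀ + a * t := by
  unfold driftedNoise
  rw [integral_add (integrable_const _) ((hW.integrable_eval _).const_mul σ), integral_const_mul,
    hW.integral_eval]
  simp

lemma exp_add_le_half_add (x y : ℝ) :
    Real.exp (x + y) ≤ (Real.exp (2 * x) + Real.exp (2 * y)) / 2 := by
  rw [Real.exp_add, two_mul, two_mul, Real.exp_add, Real.exp_add]
  nlinarith [sq_nonneg (Real.exp x - Real.exp y)]

lemma integrable_exp_driftedNoise_add (hW : IsPreBrownianReal W P)
    (hWm : ∀ t, Measurable (W t)) (p q t s : ℝ) :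
    Integrable (fun ω => Real.exp
      (p * driftedNoise v₀ a σ W t ω + q * driftedNoise v₀ a σ W s ω)) P := by
  have ht := measurable_driftedNoise (v₀ := v₀) (a := a) (σ := σ) hWm t
  have hs := measurable_driftedNoise (v₀ := v₀) (a := a) (σ := σ) hWm s
  have it := integrable_exp_driftedNoise (v₀ := v₀) (a := a) (σ := σ) hW (2 * p) t
  have is := integrable_exp_driftedNoise (v₀ := v₀) (a := a) (σ := σ) hW (2 * q) s
  refine ((it.add is).div_const 2).mono' (by fun_prop)
    (ae_of_all _ fun ω => ?_)
  rw [Real.norm_of_nonneg (Real.exp_nonneg _)]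
  simpa only [Pi.add_apply, mul_assoc] using exp_add_le_half_add (p * _) (q * _)

/-- Two-point exponential moments of Brownian motion with drift converge as both times tend to `0`.
The joint law of the two values is not needed: the tangent line inequality `1 + x ≤ exp x` bounds
the moment from below by one-point expectations, and the arithmetic-geometric mean inequality
bounds it from above by one-point exponential moments. -/
lemma tendsto_integral_exp_driftedNoise_add [IsProbabilityMeasure P]
    (hW : IsPreBrownianReal W P) (hWm : ∀ t, Measurable (W t)) (p q : ℝ) {ε : ℝ} (hε : 0 < ε) :
    ∃ δ > 0, ∀ s t, 0 ≤ s → s ≤ t → t < δ →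
      |∫ ω, Real.exp (p * driftedNoise v₀ a σ W t ω + q * driftedNoise v₀ a σ W s ω) ∂P -
        Real.exp ((p + q) * v₀)| ≤ ε := by
  let lo : ℝ × ℝ → ℝ := fun z => Real.exp ((p + q) * v₀) * (1 + p * a * z.2 + q * a * z.1)
  let up : ℝ × ℝ → ℝ := fun z => Real.exp ((p + q) * v₀) *
    ((Real.exp ((2 * p * a + (2 * p) ^ 2 * σ ^ 2 / 2) * z.2) +
      Real.exp ((2 * q * a + (2 * q) ^ 2 * σ ^ 2 / 2) * z.1)) / 2)
  have hlo : Continuous lo := by fun_prop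
  have hup : Continuous up := by fun_prop
  obtain ⟨δ₁, hδ₁, h₁⟩ := Metric.continuousAt_iff.1 (hlo.continuousAt (x := (0, 0))) ε hε
  obtain ⟨δ₂, hδ₂, h₂⟩ := Metric.continuousAt_iff.1 (hup.continuousAt (x := (0, 0))) ε hε
  refine ⟨min δ₁ δ₂, lt_min hδ₁ hδ₂, fun s t hs hst ht => ?_⟩
  have ht₀ : 0 ≤ t := hs.trans hst
  have hdist : dist (s, t) ((0 : ℝ), (0 : ℝ)) < min δ₁ δ₂ := by
    rw [Prod.dist_eq, max_lt_iff]
    simp only [Real.dist_eq, sub_zero, abs_of_nonneg hs, abs_of_nonneg ht₀]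
    exact ⟨hst.trans_lt ht, ht⟩
  have h₁ := h₁ (hdist.trans_le (min_le_left _ _))
  have h₂ := h₂ (hdist.trans_le (min_le_right _ _))
  have hlo0 : lo (0, 0) = Real.exp ((p + q) * v₀) := by simp [lo]
  have hup0 : up (0, 0) = Real.exp ((p + q) * v₀) := by simp [up]
  rw [hlo0, Real.dist_eq] at h₁
  rw [hup0, Real.dist_eq] at h₂
  set X := driftedNoise v₀ a σ W with hX
  have hint := integrable_exp_driftedNoise_add (v₀ := v₀) (a := a) (σ := σ) hW hWm p q t s
  have hXt : Integrable (fun ω => p * X t ω) P := (integrable_driftedNoise hW t).const_mul p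
  have hXs : Integrable (fun ω => q * X s ω) P := (integrable_driftedNoise hW s).const_mul q
  have hge : lo (s, t) ≤ ∫ ω, Real.exp (p * X t ω + q * X s ω) ∂P := by
    have hlin : ∫ ω, Real.exp ((p + q) * v₀) * ((p * X t ω + q * X s ω) +
        (1 - (p + q) * v₀)) ∂P = lo (s, t) := by
      rw [integral_const_mul, integral_add (f := fun ω => p * X t ω + q * X s ω) (hXt.add hXs)
        (integrable_const _), integral_add hXt hXs, integral_const_mul, integral_const_mul,
        integral_driftedNoise hW, integral_driftedNoise hW]
      simp only [integral_const, probReal_univ, one_smul, lo]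
      ring
    rw [← hlin]
    refine integral_mono (((hXt.add hXs).add (integrable_const _)).const_mul _) hint fun ω => ?_
    have := Real.add_one_le_exp (p * X t ω + q * X s ω - (p + q) * v₀)
    calc Real.exp ((p + q) * v₀) * ((p * X t ω + q * X s ω) + (1 - (p + q) * v₀))
        ≤ Real.exp ((p + q) * v₀) * Real.exp (p * X t ω + q * X s ω - (p + q) * v₀) := by
          gcongr; linarith
      _ = Real.exp (p * X t ω + q * X s ω) := by rw [← Real.exp_add]; ring_nf
  have hle : ∫ ω, Real.exp (p * X t ω + q * X s ω) ∂P ≤ up (s, t) := by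
    have it := integrable_exp_driftedNoise (v₀ := v₀) (a := a) (σ := σ) hW (2 * p) t
    have is := integrable_exp_driftedNoise (v₀ := v₀) (a := a) (σ := σ) hW (2 * q) s
    -- The factors `exp (± (q - p) v₀)` centre both exponents at `(p + q) v₀`.
    have hval : ∫ ω, (Real.exp ((q - p) * v₀) * Real.exp (2 * p * X t ω) +
        Real.exp ((p - q) * v₀) * Real.exp (2 * q * X s ω)) / 2 ∂P = up (s, t) := by
      rw [integral_div, integral_add (it.const_mul _) (is.const_mul _), integral_const_mul,
        integral_const_mul, integral_exp_driftedNoise hW _ ht₀, integral_exp_driftedNoise hW _ hs]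
      simp only [up, ← Real.exp_add, mul_div_assoc', mul_add]
      ring_nf
    rw [← hval]
    refine integral_mono hint (((it.const_mul _).add (is.const_mul _)).div_const 2) fun ω => ?_
    have := exp_add_le_half_add (p * X t ω + (q - p) * v₀ / 2) (q * X s ω + (p - q) * v₀ / 2)
    refine (le_of_eq ?_).trans (this.trans (le_of_eq ?_))
    · ring_nf
    · simp only [← Real.exp_add]
      ring_nf
  rw [abs_lt] at h₁ h₂
  rw [abs_le]
  constructor <;> linarith

lemma integrable_prod_exp_driftedNoise_add [IsProbabilityMeasure P]
    (hW : IsPreBrownianReal W P) (hWm : ∀ t, Measurable (W t))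
    (hWc : ∀ ω, Continuous fun t => W t ω) (p q : ℝ) {t : ℝ} (ht : 0 ≤ t) :
    Integrable (Function.uncurry fun s ω => Real.exp
      (p * driftedNoise v₀ a σ W t ω + q * driftedNoise v₀ a σ W s ω))
      ((volume.restrict (Set.uIoc 0 t)).prod P) := by
  have hX := measurable_uncurry_driftedNoise (v₀ := v₀) (a := a) (σ := σ) hWm hWc
  have hXt := measurable_driftedNoise (v₀ := v₀) (a := a) (σ := σ) hWm t
  have h₂ : Integrable (fun z : ℝ × Ω => Real.exp (2 * q * driftedNoise v₀ a σ W z.1 z.2))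
      ((volume.restrict (Set.uIoc 0 t)).prod P) := by
    refine (integrable_prod_iff ?_).2 ⟨ae_of_all _ fun s => integrable_exp_driftedNoise hW _ s, ?_⟩
    · exact (Real.measurable_exp.comp (hX.const_mul (2 * q))).aestronglyMeasurable
    · have hc : IntegrableOn (fun s : ℝ => Real.exp
          (2 * q * v₀ + (2 * q * a + (2 * q) ^ 2 * σ ^ 2 / 2) * s)) (Set.uIoc 0 t) volume :=
        intervalIntegrable_iff.1 (Continuous.intervalIntegrable (by fun_prop) _ _)
      refine hc.congr ((ae_restrict_iff' measurableSet_uIoc).2 (ae_of_all _ fun s hs => ?_))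
      rw [Set.uIoc_of_le ht] at hs
      simp only [Real.norm_of_nonneg (Real.exp_nonneg _)]
      exact (integral_exp_driftedNoise hW _ hs.1.le).symm
  have h₁ : Integrable (fun z : ℝ × Ω => Real.exp (2 * p * driftedNoise v₀ a σ W t z.2))
      ((volume.restrict (Set.uIoc 0 t)).prod P) := by
    rw [Set.uIoc_of_le ht]
    exact (integrable_exp_driftedNoise hW (2 * p) t).comp_snd _
  refine ((h₁.add h₂).div_const 2).mono' ?_ (ae_of_all _ fun z => ?_)
  · exact (Real.measurable_exp.comp (((hXt.comp measurable_snd).const_mul p).add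
      (hX.const_mul q))).aestronglyMeasurable
  · simp only [Function.uncurry]
    rw [Real.norm_of_nonneg (Real.exp_nonneg _)]
    simpa only [Pi.add_apply, mul_assoc] using exp_add_le_half_add (p * _) (q * _)

lemma integrable_exp_mul_intervalIntegral_driftedNoise [IsProbabilityMeasure P]
    (hW : IsPreBrownianReal W P) (hWm : ∀ t, Measurable (W t))
    (hWc : ∀ ω, Continuous fun t => W t ω) (p q : ℝ) {t : ℝ} (ht : 0 ≤ t) :
    Integrable (fun ω => Real.exp (p * driftedNoise v₀ a σ W t ω) *
      ∫ s in (0 : ℝ)..t, Real.exp (q * driftedNoise v₀ a σ W s ω)) P := by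
  simp only [exp_mul_intervalIntegral_driftedNoise]
  simp only [intervalIntegral.integral_of_le ht]
  have := integrable_prod_exp_driftedNoise_add (v₀ := v₀) (a := a) (σ := σ) hW hWm hWc p q ht
  rw [Set.uIoc_of_le ht] at this
  exact this.integral_prod_right

/-- To first order in `t`, integrating `exp (q X_s)` over `[0, t]` against the weight `exp (p X_t)`
amounts to freezing the process `X` at its initial value. -/
lemma tendsto_integral_exp_mul_intervalIntegral_driftedNoise [IsProbabilityMeasure P]
    (hW : IsPreBrownianReal W P) (hWm : ∀ t, Measurable (W t))
    (hWc : ∀ ω, Continuous fun t => W t ω) (p q : ℝ) :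
    Tendsto (fun t => (∫ ω, Real.exp (p * driftedNoise v₀ a σ W t ω) *
      (∫ s in (0 : ℝ)..t, Real.exp (q * driftedNoise v₀ a σ W s ω)) ∂P) / t)
      (𝓝[>] 0) (𝓝 (Real.exp ((p + q) * v₀))) := by
  rw [Metric.tendsto_nhds]
  intro ε hε
  obtain ⟨δ, hδ, h⟩ := tendsto_integral_exp_driftedNoise_add (v₀ := v₀) (a := a) (σ := σ)
    hW hWm p q (half_pos hε)
  filter_upwards [Ioo_mem_nhdsGT hδ] with t ht
  have hprod := integrable_prod_exp_driftedNoise_add (v₀ := v₀) (a := a) (σ := σ)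
    hW hWm hWc p q ht.1.le
  simp only [exp_mul_intervalIntegral_driftedNoise]
  rw [← intervalIntegral_integral_swap hprod]
  set G : ℝ → ℝ := fun s => ∫ ω, Real.exp
    (p * driftedNoise v₀ a σ W t ω + q * driftedNoise v₀ a σ W s ω) ∂P with hG
  have hGi : IntervalIntegrable G volume 0 t := by
    rw [intervalIntegrable_iff]
    exact hprod.integral_prod_left
  have hb : ‖∫ s in (0 : ℝ)..t, (G s - Real.exp ((p + q) * v₀))‖ ≤ ε / 2 * |t - 0| := by
    refine intervalIntegral.norm_integral_le_of_norm_le_const fun s hs => ?_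
    rw [Set.uIoc_of_le ht.1.le] at hs
    exact h s t hs.1.le hs.2 ht.2
  rw [intervalIntegral.integral_sub hGi (by simp), intervalIntegral.integral_const, sub_zero,
    abs_of_pos ht.1, smul_eq_mul, Real.norm_eq_abs] at hb
  have ht₀ := ht.1
  have heq : (∫ s in (0 : ℝ)..t, G s) / t - Real.exp ((p + q) * v₀) =
      ((∫ s in (0 : ℝ)..t, G s) - t * Real.exp ((p + q) * v₀)) / t := by field_simp
  rw [Real.dist_eq, heq, abs_div, abs_of_pos ht₀, div_lt_iff₀ ht₀]
  nlinarith

end DriftedNoise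

/-! ### First-order expansions at `0` -/

lemma isLittleO_sub_affine_of_tendsto_slope {f : ℝ → ℝ} {c d : ℝ}
    (h : Tendsto (fun t => (f t - c) / t) (𝓝[>] 0) (𝓝 d)) :
    (fun t => f t - (c + d * t)) =o[𝓝[>] (0 : ℝ)] (fun t : ℝ => t) := by
  refine (Asymptotics.isLittleO_iff_tendsto' ?_).2 ?_
  · filter_upwards [self_mem_nhdsWithin] with t ht h0 using absurd h0 (ne_of_gt ht)
  · have := h.sub_const d
    rw [sub_self] at this
    refine this.congr' ?_
    filter_upwards [self_mem_nhdsWithin] with t ht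
    have : t ≠ 0 := ne_of_gt ht
    field_simp
    ring

/-- Averaging over `[0, t]` halves the slope of a first-order expansion at `0`. -/
lemma isLittleO_average_sub_affine {f : ℝ → ℝ} {c d : ℝ}
    (hf : ∀ t, 0 < t → IntervalIntegrable f volume 0 t)
    (h : (fun t => f t - (c + d * t)) =o[𝓝[>] (0 : ℝ)] (fun t : ℝ => t)) :
    (fun t => (∫ s in (0 : ℝ)..t, f s) / t - (c + d * (t / 2))) =o[𝓝[>] (0 : ℝ)]
      (fun t : ℝ => t) := by
  refine Asymptotics.isLittleO_iff.2 fun ε hε => ?_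
  obtain ⟨δ, hδ, hb⟩ := mem_nhdsGT_iff_exists_Ioo_subset.1 (Asymptotics.isLittleO_iff.1 h hε)
  filter_upwards [Ioo_mem_nhdsGT hδ] with t ht
  have ht₀ : 0 < t := ht.1
  have hmain : ‖∫ s in (0 : ℝ)..t, (f s - (c + d * s))‖ ≤ ε * t * |t - 0| := by
    refine intervalIntegral.norm_integral_le_of_norm_le_const fun s hs => ?_
    rw [Set.uIoc_of_le ht₀.le] at hs
    refine (hb ⟨hs.1, hs.2.trans_lt ht.2⟩ : _ ≤ ε * ‖s‖).trans ?_
    rw [Real.norm_of_nonneg hs.1.le]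
    exact mul_le_mul_of_nonneg_left hs.2 hε.le
  have hval : (∫ s in (0 : ℝ)..t, (f s - (c + d * s))) =
      (∫ s in (0 : ℝ)..t, f s) - (c * t + d * (t ^ 2 / 2)) := by
    rw [intervalIntegral.integral_sub (hf t ht₀) (Continuous.intervalIntegrable (by fun_prop) _ _),
      intervalIntegral.integral_add (by simp) (Continuous.intervalIntegrable (by fun_prop) _ _),
      intervalIntegral.integral_const_mul, integral_id]
    simp [mul_comm]
  have heq : (∫ s in (0 : ℝ)..t, f s) / t - (c + d * (t / 2)) =
      (∫ s in (0 : ℝ)..t, (f s - (c + d * s))) / t := by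
    rw [hval]; field_simp
  rw [sub_zero, abs_of_pos ht₀] at hmain
  rw [heq, norm_div, Real.norm_of_nonneg ht₀.le, div_le_iff₀ ht₀]
  exact hmain

lemma isEquivalent_of_isLittleO_sub {f g : ℝ → ℝ} {c : ℝ} (hc : c ≠ 0)
    (hg : Tendsto g (𝓝[>] 0) (𝓝 c))
    (h : (fun t => f t - g t) =o[𝓝[>] (0 : ℝ)] (fun t : ℝ => t)) :
    Asymptotics.IsEquivalent (𝓝[>] (0 : ℝ)) f g := by
  have h₁ : (fun t : ℝ => t) =o[𝓝[>] (0 : ℝ)] (fun _ => (1 : ℝ)) :=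
    (Asymptotics.isLittleO_one_iff ℝ).2 (tendsto_id.mono_left nhdsWithin_le_nhds)
  have h₂ : (fun _ : ℝ => (1 : ℝ)) =O[𝓝[>] (0 : ℝ)] g :=
    Asymptotics.IsBigO.of_bound (2 / ‖c‖) <| by
      have hc' : 0 < ‖c‖ := norm_pos_iff.2 hc
      filter_upwards [hg.norm.eventually_const_lt (half_lt_self hc')] with t ht
      rw [norm_one, div_mul_eq_mul_div, le_div_iff₀ hc']
      linarith
  exact (h.trans h₁).trans_isBigO h₂

/-! ### The instantaneous variance in closed form -/

/-- The closed form `exp (2 X_t) (1 + α b ∫_0^t exp (α X_s) ds) ^ (-2 / α)` of the instantaneous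
variance, where `X` is Brownian motion with drift. The power is written with `exp` and `log`;
the formula is only meaningful for `0 ≤ t`, where the base of the power is at least `1`. -/
noncomputable def explicitVariance {Ω : Type*} (b α v₀ a σ : ℝ) (W : ℝ≥0 → Ω → ℝ)
    (t : ℝ) (ω : Ω) : ℝ :=
  Real.exp (2 * driftedNoise v₀ a σ W t ω) * Real.exp (-(2 / α *
    Real.log (1 + α * b * ∫ s in (0 : ℝ)..t, Real.exp (α * driftedNoise v₀ a σ W s ω))))

lemma IsLogVolSolution.instVariance_eq_explicitVariance {Ω : Type*} [MeasurableSpace Ω]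
    {P : Measure Ω} {a b α σ v₀ : ℝ} {w v W : ℝ≥0 → Ω → ℝ} (hα : 0 < α)
    (hv : IsLogVolSolution P a b α σ v₀ w v) (hWw : ∀ᵐ ω ∂P, ∀ t, W t ω = w t ω) :
    ∀ᵐ ω ∂P, ∀ t : ℝ≥0, instVariance v t ω = explicitVariance b α v₀ a σ W t ω := by
  filter_upwards [hv.continuous_paths, hv.equation, hWw] with ω hc he hW t
  have hy : Continuous fun s : ℝ => v s.toNNReal ω := hc.comp continuous_real_toNNReal
  have := eq_sub_log_of_integral_equation (b := b) (a := a) (v₀ := v₀) hα hy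
    (x := fun s => σ * W s.toNNReal ω)
    (fun s hs => by simpa only [Real.coe_toNNReal s hs, hW] using he s.toNNReal) t.coe_nonneg
  rw [Real.toNNReal_coe] at this
  rw [instVariance, this, explicitVariance, ← Real.exp_add]
  simp only [driftedNoise, Real.toNNReal_coe]
  ring_nf

section ExplicitVariance

variable {Ω : Type*} {b α v₀ a σ : ℝ} {W : ℝ≥0 → Ω → ℝ}

lemma intervalIntegral_exp_driftedNoise_nonneg {t : ℝ} (ht : 0 ≤ t) (ω : Ω) :
    0 ≤ ∫ s in (0 : ℝ)..t, Real.exp (α * driftedNoise v₀ a σ W s ω) :=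
  intervalIntegral.integral_nonneg ht fun _ _ => Real.exp_nonneg _

lemma explicitVariance_nonneg (t : ℝ) (ω : Ω) : 0 ≤ explicitVariance b α v₀ a σ W t ω :=
  mul_nonneg (Real.exp_nonneg _) (Real.exp_nonneg _)

lemma explicitVariance_le (hα : 0 < α) (hb : 0 < b) {t : ℝ} (ht : 0 ≤ t) (ω : Ω) :
    explicitVariance b α v₀ a σ W t ω ≤ Real.exp (2 * driftedNoise v₀ a σ W t ω) := by
  have hY := intervalIntegral_exp_driftedNoise_nonneg (α := α) (v₀ := v₀) (a := a) (σ := σ)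
    (W := W) ht ω
  refine mul_le_of_le_one_right (Real.exp_nonneg _) (Real.exp_le_one_iff.2 ?_)
  have : 0 ≤ Real.log (1 + α * b * ∫ s in (0 : ℝ)..t, Real.exp (α * driftedNoise v₀ a σ W s ω)) :=
    Real.log_nonneg (by nlinarith [mul_nonneg (mul_pos hα hb).le hY])
  have := mul_nonneg (by positivity : 0 ≤ 2 / α) this
  linarith

variable [MeasurableSpace Ω] {P : Measure Ω}

lemma measurable_uncurry_explicitVariance (hWm : ∀ t, Measurable (W t))
    (hWc : ∀ ω, Continuous fun t => W t ω) :
    Measurable (Function.uncurry (explicitVariance b α v₀ a σ W)) := by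
  have hX := measurable_uncurry_driftedNoise (v₀ := v₀) (a := a) (σ := σ) hWm hWc
  have hE : Measurable fun z : Ω × ℝ => Real.exp (α * driftedNoise v₀ a σ W z.2 z.1) :=
    Real.measurable_exp.comp ((hX.comp measurable_swap).const_mul α)
  have hY : Measurable (Function.uncurry fun (t : ℝ) (ω : Ω) =>
      ∫ s in (0 : ℝ)..t, Real.exp (α * driftedNoise v₀ a σ W s ω)) := by
    refine measurable_uncurry_of_continuous_of_measurable (fun ω => ?_) (fun t => ?_)
    · have := continuous_driftedNoise (v₀ := v₀) (a := a) (σ := σ) hWc ω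
      exact intervalIntegral.continuous_primitive
        (fun _ _ => Continuous.intervalIntegrable (by fun_prop) _ _) 0
    · simp only [intervalIntegral]
      exact (hE.stronglyMeasurable.integral_prod_right'.measurable).sub
        (hE.stronglyMeasurable.integral_prod_right'.measurable)
  exact (Real.measurable_exp.comp (hX.const_mul 2)).mul
    (Real.measurable_exp.comp ((Real.measurable_log.comp
      ((hY.const_mul (α * b)).const_add 1)).const_mul (2 / α)).neg)

lemma integrable_explicitVariance (hα : 0 < α) (hb : 0 < b) (hW : IsPreBrownianReal W P)
    (hWm : ∀ t, Measurable (W t)) (hWc : ∀ ω, Continuous fun t => W t ω) {t : ℝ} (ht : 0 ≤ t) :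
    Integrable (explicitVariance b α v₀ a σ W t) P := by
  have hm : Measurable (explicitVariance b α v₀ a σ W t) :=
    (measurable_uncurry_explicitVariance hWm hWc).comp measurable_prodMk_left
  refine (integrable_exp_driftedNoise (v₀ := v₀) (a := a) (σ := σ) hW 2 t).mono'
    hm.aestronglyMeasurable
    (ae_of_all _ fun ω => ?_)
  rw [Real.norm_of_nonneg (explicitVariance_nonneg t ω)]
  exact explicitVariance_le hα hb ht ω

lemma intervalIntegrable_integral_explicitVariance [IsProbabilityMeasure P] (hα : 0 < α)
    (hb : 0 < b) (hW : IsPreBrownianReal W P) (hWm : ∀ t, Measurable (W t))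
    (hWc : ∀ ω, Continuous fun t => W t ω) {t : ℝ} (ht : 0 ≤ t) :
    IntervalIntegrable (fun s => ∫ ω, explicitVariance b α v₀ a σ W s ω ∂P) volume 0 t := by
  have hm : StronglyMeasurable fun s => ∫ ω, explicitVariance b α v₀ a σ W s ω ∂P :=
    (measurable_uncurry_explicitVariance hWm hWc).stronglyMeasurable.integral_prod_right
  refine IntervalIntegrable.mono_fun'
    (g := fun s => Real.exp (2 * v₀ + (2 * a + 2 ^ 2 * σ ^ 2 / 2) * s))
    (Continuous.intervalIntegrable (by fun_prop) _ _) hm.aestronglyMeasurable ?_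
  refine (ae_restrict_iff' measurableSet_uIoc).2 (ae_of_all _ fun s hs => ?_)
  rw [Set.uIoc_of_le ht] at hs
  dsimp only
  rw [Real.norm_of_nonneg (integral_nonneg (explicitVariance_nonneg s)),
    ← integral_exp_driftedNoise hW 2 hs.1.le]
  exact integral_mono (integrable_explicitVariance hα hb hW hWm hWc hs.1.le)
    (integrable_exp_driftedNoise hW 2 s) fun ω => explicitVariance_le hα hb hs.1.le ω

/-- The first-order expansion of the expected variance. The discount factor
`(1 + α b Y) ^ (-2 / α)` lies between `1 - 2 b Y` and `1 - 2 b Y + C Y ^ 2`, and the expectation of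
the quadratic term is `O(t ^ 2)`. -/
lemma tendsto_slope_integral_explicitVariance [IsProbabilityMeasure P] (hα : 0 < α)
    (hb : 0 < b) (hW : IsPreBrownianReal W P) (hWm : ∀ t, Measurable (W t))
    (hWc : ∀ ω, Continuous fun t => W t ω) :
    Tendsto (fun t => ((∫ ω, explicitVariance b α v₀ a σ W t ω ∂P) - Real.exp (2 * v₀)) / t)
      (𝓝[>] 0) (𝓝 (Real.exp (2 * v₀) * (2 * a + 2 * σ ^ 2) -
        2 * b * Real.exp ((2 + α) * v₀))) := by
  set X := driftedNoise v₀ a σ W with hX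
  set H : ℝ → ℝ → ℝ := fun q t => ∫ ω, Real.exp (2 * X t ω) *
    (∫ s in (0 : ℝ)..t, Real.exp (q * X s ω)) ∂P with hH
  have hHlim : ∀ q, Tendsto (fun t => H q t / t) (𝓝[>] 0) (𝓝 (Real.exp ((2 + q) * v₀))) :=
    tendsto_integral_exp_mul_intervalIntegral_driftedNoise hW hWm hWc 2
  set C := 2 * α * b ^ 2 + 4 * b ^ 2 with hC
  set M : ℝ → ℝ := fun t => Real.exp (2 * v₀ + (2 * a + 2 ^ 2 * σ ^ 2 / 2) * t) with hM
  have hMlim : Tendsto (fun t => (M t - Real.exp (2 * v₀)) / t) (𝓝[>] 0)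
      (𝓝 (Real.exp (2 * v₀) * (2 * a + 2 * σ ^ 2))) := by
    have hd : HasDerivAt M (Real.exp (2 * v₀) * (2 * a + 2 * σ ^ 2)) 0 := by
      have := (((hasDerivAt_id (0 : ℝ)).const_mul (2 * a + 2 ^ 2 * σ ^ 2 / 2)).const_add
        (2 * v₀)).exp
      convert! this using 1
      simp
      ring
    have := hd.tendsto_slope_zero_right
    refine this.congr fun t => ?_
    simp [hM, div_eq_inv_mul]
  have hbounds : ∀ t, 0 < t →
      M t - 2 * b * H α t ≤ ∫ ω, explicitVariance b α v₀ a σ W t ω ∂P ∧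
      ∫ ω, explicitVariance b α v₀ a σ W t ω ∂P ≤
        M t - 2 * b * H α t + C * t * H (2 * α) t := by
    intro t ht
    have iX := integrable_exp_driftedNoise (v₀ := v₀) (a := a) (σ := σ) hW 2 t
    have i₁ := integrable_exp_mul_intervalIntegral_driftedNoise (v₀ := v₀) (a := a) (σ := σ)
      hW hWm hWc 2 α ht.le
    have i₂ := integrable_exp_mul_intervalIntegral_driftedNoise (v₀ := v₀) (a := a) (σ := σ)
      hW hWm hWc 2 (2 * α) ht.le
    have iU := integrable_explicitVariance (v₀ := v₀) (a := a) (σ := σ) hα hb hW hWm hWc ht.le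
    have iL : Integrable (fun ω => Real.exp (2 * X t ω) - 2 * b * (Real.exp (2 * X t ω) *
        ∫ s in (0 : ℝ)..t, Real.exp (α * X s ω))) P := iX.sub (i₁.const_mul _)
    have e₁ : ∫ ω, (Real.exp (2 * X t ω) - 2 * b * (Real.exp (2 * X t ω) *
        ∫ s in (0 : ℝ)..t, Real.exp (α * X s ω))) ∂P = M t - 2 * b * H α t := by
      rw [integral_sub iX (i₁.const_mul _), integral_const_mul,
        integral_exp_driftedNoise hW 2 ht.le]
    have e₂ : ∫ ω, ((Real.exp (2 * X t ω) - 2 * b * (Real.exp (2 * X t ω) *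
        ∫ s in (0 : ℝ)..t, Real.exp (α * X s ω))) + C * t * (Real.exp (2 * X t ω) *
        ∫ s in (0 : ℝ)..t, Real.exp (2 * α * X s ω))) ∂P =
        M t - 2 * b * H α t + C * t * H (2 * α) t := by
      rw [integral_add iL (i₂.const_mul _), integral_const_mul, e₁]
    rw [← e₂, ← e₁]
    constructor
    · refine integral_mono iL iU fun ω => ?_
      have hY := intervalIntegral_exp_driftedNoise_nonneg (α := α) (v₀ := v₀) (a := a) (σ := σ)
        (W := W) ht.le ω
      refine le_trans (le_of_eq ?_) (mul_le_mul_of_nonneg_left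
        (one_sub_le_exp_neg_log hα hb hY) (Real.exp_nonneg _))
      simp only [hX]
      ring
    · refine integral_mono iU (iL.add (i₂.const_mul _)) fun ω => ?_
      have hY := intervalIntegral_exp_driftedNoise_nonneg (α := α) (v₀ := v₀) (a := a) (σ := σ)
        (W := W) ht.le ω
      have hXc := continuous_driftedNoise (v₀ := v₀) (a := a) (σ := σ) hWc ω
      have hsq := sq_intervalIntegral_le (f := fun s => Real.exp (α * X s ω)) (by fun_prop) ht
      have hpow : ∀ s, Real.exp (α * X s ω) ^ 2 = Real.exp (2 * α * X s ω) := fun s => by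
        rw [← Real.exp_nat_mul]; push_cast; ring_nf
      simp only [hpow] at hsq
      have hC₀ : 0 ≤ C := by positivity
      refine (mul_le_mul_of_nonneg_left
        ((exp_neg_log_le_quadratic hα hb hY).trans
          (add_le_add_right (mul_le_mul_of_nonneg_left hsq hC₀) _)) (Real.exp_nonneg _)).trans
        (le_of_eq ?_)
      simp only [hX]
      ring
  have hlow : Tendsto (fun t => (M t - Real.exp (2 * v₀)) / t - 2 * b * (H α t / t)) (𝓝[>] 0)
      (𝓝 (Real.exp (2 * v₀) * (2 * a + 2 * σ ^ 2) - 2 * b * Real.exp ((2 + α) * v₀))) :=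
    hMlim.sub ((hHlim α).const_mul (2 * b))
  have hupp : Tendsto (fun t => (M t - Real.exp (2 * v₀)) / t - 2 * b * (H α t / t) +
      C * t * (H (2 * α) t / t)) (𝓝[>] 0)
      (𝓝 (Real.exp (2 * v₀) * (2 * a + 2 * σ ^ 2) - 2 * b * Real.exp ((2 + α) * v₀))) := by
    have ht : Tendsto (fun t : ℝ => C * t) (𝓝[>] 0) (𝓝 (C * 0)) :=
      (tendsto_id.mono_left nhdsWithin_le_nhds).const_mul C
    simpa using hlow.add (ht.mul (hHlim (2 * α)))
  refine tendsto_of_tendsto_of_tendsto_of_le_of_le' hlow hupp ?_ ?_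
  · filter_upwards [self_mem_nhdsWithin] with t ht
    have ht : 0 < t := ht
    exact (le_of_eq (by ring)).trans (div_le_div_of_nonneg_right
      (sub_le_sub_right (hbounds t ht).1 (Real.exp (2 * v₀))) ht.le)
  · filter_upwards [self_mem_nhdsWithin] with t ht
    have ht : 0 < t := ht
    exact (div_le_div_of_nonneg_right
      (sub_le_sub_right (hbounds t ht).2 (Real.exp (2 * v₀))) ht.le).trans (le_of_eq (by ring))

end ExplicitVariance

/-! ### Expansions of the expected variance and of the variance swap -/

theorem proposition3 {Ω : Type*} [MeasurableSpace Ω] (P : Measure Ω) [IsProbabilityMeasure P]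
    (a b α σ v₀ V₀ : ℝ) (hα : 0 < α) (hb : 0 < b) (hσ : 0 < σ) (hV₀ : V₀ = Real.exp (2 * v₀))
    (w v : ℝ≥0 → Ω → ℝ) (hw : IsBrownianReal w P)
    (hv : IsLogVolSolution P a b α σ v₀ w v) :
    -- the expectations and the time integral are genuine
    (∀ t : ℝ≥0, Integrable (instVariance v t) P) ∧
    (∀ t : ℝ, 0 < t → IntervalIntegrable (expVariance P v) volume 0 t) ∧
    -- the first-order expansions as `t → 0`, `t > 0`
    (fun t : ℝ => expVariance P v t -
        V₀ * (1 + (2 * a + (2 * σ) ^ 2 / 2 - 2 * b * V₀ ^ (α / 2)) * t))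
      =o[𝓝[>] (0 : ℝ)] (fun t : ℝ => t) ∧
    (fun t : ℝ => varianceSwap P v t -
        V₀ * (1 + (2 * a + (2 * σ) ^ 2 / 2 - 2 * b * V₀ ^ (α / 2)) * (t / 2)))
      =o[𝓝[>] (0 : ℝ)] (fun t : ℝ => t) ∧
    -- the asymptotic equivalences as `t → 0`, `t > 0`
    Asymptotics.IsEquivalent (𝓝[>] (0 : ℝ)) (fun t : ℝ => expVariance P v t)
      (fun t : ℝ => V₀ * (1 + (2 * a + (2 * σ) ^ 2 / 2 - 2 * b * V₀ ^ (α / 2)) * t)) ∧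
    Asymptotics.IsEquivalent (𝓝[>] (0 : ℝ)) (fun t : ℝ => varianceSwap P v t)
      (fun t : ℝ => V₀ * (1 + (2 * a + (2 * σ) ^ 2 / 2 - 2 * b * V₀ ^ (α / 2)) * (t / 2))) := by
  obtain ⟨W, hWm, hWc, hWw⟩ := hw.exists_measurable_continuous_version
  have hW : IsPreBrownianReal W P := hw.toIsPreBrownianReal.congr fun t => by
    filter_upwards [hWw] with ω h using (h t).symm
  have hVU := hv.instVariance_eq_explicitVariance hα hWw
  have hE : ∀ t, 0 ≤ t →
      expVariance P v t = ∫ ω, explicitVariance b α v₀ a σ W t ω ∂P := by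
    intro t ht
    refine integral_congr_ae ?_
    filter_upwards [hVU] with ω h
    simpa only [Real.coe_toNNReal t ht] using h t.toNNReal
  have hpow : V₀ ^ (α / 2) = Real.exp (α * v₀) := by
    rw [hV₀, ← Real.exp_mul]
    ring_nf
  have hpos : V₀ ≠ 0 := hV₀ ▸ Real.exp_ne_zero _
  have hint : ∀ t : ℝ, 0 < t → IntervalIntegrable (expVariance P v) volume 0 t := by
    intro t ht
    refine (intervalIntegrable_integral_explicitVariance (v₀ := v₀) (a := a) (σ := σ)
      hα hb hW hWm hWc ht.le).congr fun s hs => ?_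
    rw [Set.uIoc_of_le ht.le] at hs
    exact (hE s hs.1.le).symm
  have hslope : Tendsto (fun t => (expVariance P v t - V₀) / t) (𝓝[>] 0)
      (𝓝 (V₀ * (2 * a + (2 * σ) ^ 2 / 2 - 2 * b * V₀ ^ (α / 2)))) := by
    have hlim : V₀ * (2 * a + (2 * σ) ^ 2 / 2 - 2 * b * V₀ ^ (α / 2)) =
        Real.exp (2 * v₀) * (2 * a + 2 * σ ^ 2) - 2 * b * Real.exp ((2 + α) * v₀) := by
      rw [hpow, hV₀, add_mul, Real.exp_add]
      ring
    rw [hlim]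
    refine (tendsto_slope_integral_explicitVariance hα hb hW hWm hWc).congr' ?_
    filter_upwards [self_mem_nhdsWithin] with t ht
    rw [hE t (le_of_lt ht), hV₀]
  set κ := 2 * a + (2 * σ) ^ 2 / 2 - 2 * b * V₀ ^ (α / 2) with hκ
  have h₁ := isLittleO_sub_affine_of_tendsto_slope hslope
  have h₂ := isLittleO_average_sub_affine hint h₁
  simp only [mul_assoc, ← mul_one_add] at h₁ h₂
  have hexp : (fun t : ℝ => expVariance P v t - V₀ * (1 + κ * t)) =o[𝓝[>] (0 : ℝ)]
      (fun t : ℝ => t) := h₁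
  have hvs : (fun t : ℝ => varianceSwap P v t - V₀ * (1 + κ * (t / 2))) =o[𝓝[>] (0 : ℝ)]
      (fun t : ℝ => t) := h₂
  refine ⟨fun t => ?_, hint, hexp, hvs, isEquivalent_of_isLittleO_sub hpos ?_ hexp,
    isEquivalent_of_isLittleO_sub hpos ?_ hvs⟩
  · refine (integrable_explicitVariance (v₀ := v₀) (a := a) (σ := σ)
      hα hb hW hWm hWc t.coe_nonneg).congr ?_
    filter_upwards [hVU] with ω h using (h t).symm
  · have : Continuous fun t : ℝ => V₀ * (1 + κ * t) := by fun_prop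
    simpa using (this.tendsto 0).mono_left nhdsWithin_le_nhds
  · have : Continuous fun t : ℝ => V₀ * (1 + κ * (t / 2)) := by fun_prop
    simpa using (this.tendsto 0).mono_left nhdsWithin_le_nhds
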